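/- A \emph{QNP} $Q=\langle At,V,I,O,G\rangle$ has a finite set $At$ of boolean atoms, a finite set $V$ of numerical variables, and a set $O$ of actions. Literals are $p,\neg p$ ($p\in At$) and $X=0,\ X>0$ ($X\in V$). $I$ is a maximal consistent set of literals and $G$ is a set of literals. An action $a\in O$ has precondition literals, effect literals over $At$, and sets $\mathrm{Inc}(a),\mathrm{Dec}(a)\subseteq V$ of incremented and decremented variables that are disjoint, where $X>0$ is a precondition of $a$ for each $X\in\mathrm{Dec}(a)$. \emph{Solutions of $Q$.} A state of $Q$ assigns truth values to the atoms and non-negative reals to the variables. Its qualitative state consists of the truth values of the atoms and of the expressions $X=0$. A policy $\pi$ is a partial function from non-goal qualitative states to actions. Executing an applicable action makes its effect literals true, strictly increases each incremented variable, strictly decreases each decremented variable (keeping it $\ge 0$), and changes nothing else. For $\varepsilon>0$, a trajectory of $Q$ is $\varepsilon$-\emph{bounded} if every increment and decrement in it is by at least $\varepsilon$, except that a decrement that takes a variable to $0$ may be smaller. A trajectory compatible with $\pi$ starts in a state satisfying $I$ and applies in each state the action that $\pi$ prescribes for its qualitative state. It is \emph{maximal} if it is infinite, or ends in its first goal state,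 or ends in a state where $\pi$ prescribes no action or a non-applicable one. The policy $\pi$ \emph{solves} $Q$ if for every $\varepsilon>0$ every maximal $\varepsilon$-bounded trajectory compatible with $\pi$ reaches a goal state. \emph{Direct translation.} The FOND problem $P=T_D(Q)$ has the atoms $At\cup\{p_X: X\in V\}$, where $p_X$ stands for $X=0$. Literals $X=0$ and $X>0$ in $I$, $G$ and preconditions are replaced by $p_X$ and $\neg p_X$; an increment of $X$ becomes the effect $\neg p_X$, and a decrement of $X$ becomes the non-deterministic effect $\mathrm{oneof}(p_X,\neg p_X)$. Actions of $P$ with these effects are said to increment, respectively decrement, $X$. The states of $P$ are the qualitative states of $Q$, $F(a,s)$ is the set of possible successors of $s$ under $a$ (empty if $a$ is not applicable in $s$), and a $\pi$-trajectory of $P$ is a sequence $s_0,s_1,\dots$ starting in the initial state with $s_{i+1}\in F(\pi(s_i),s_i)$. The policy $\pi$ is a \emph{strong-cyclic solution} of $P$ if it reaches a goal state from every state that it reaches. \emph{Termination.} A cycle on $s$ is a path of length at least one (possibly repeating nodes) from $s$ to itself along transitions $(t,t')$ with $t'\in F(\pi(t),t)$. Inductively (as the least set of states satisfying this), a state $s$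 \emph{terminates} iff (1) there is no cycle on $s$; or (2) every cycle on $s$ contains a state that terminates; or (3) $\pi(s)$ decrements some variable $X$ such that every cycle on $s$ containing a state $s'$ for which $\pi(s')$ increments $X$ also contains a state that terminates. The policy $\pi$ \emph{terminates} in $P$ if every state reached by $\pi$ in $P$ terminates. \textbf{Theorem.} Let $Q$ be a QNP and let $\pi$ be a policy. Then $\pi$ solves $Q$ if and only if $\pi$ is a strong-cyclic solution of $T_D(Q)$ that terminates in $T_D(Q)$. -/

import Mathlib

/-! ## FOND problems -/

/-- Literals over a type of boolean atoms. -/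
inductive Lit (Atom : Type*) where
  | pos (p : Atom)
  | neg (p : Atom)

/-- A state is represented by the set of atoms that are true in it. -/
def Lit.Holds {Atom : Type*} (s : Set Atom) : Lit Atom → Prop
  | .pos p => p ∈ s
  | .neg p => p ∉ s

/-- The state that results from `s` by making the literals in `E` true. -/
def applyEffects {Atom : Type*} (E : Set (Lit Atom)) (s : Set Atom) : Set Atom :=
  {p | Lit.pos p ∈ E ∨ (p ∈ s ∧ Lit.neg p ∉ E)}

/-- A FOND action: preconditions, deterministic effects, and a set of non-deterministic effects
`oneof(E₁, …, Eₙ)`, each of them given as the set `{E₁, …, Eₙ}` of its alternatives. -/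
structure FONDAction (Atom : Type*) where
  pre : Set (Lit Atom)
  det : Set (Lit Atom)
  oneofs : Set (Set (Set (Lit Atom)))

/-- A FOND problem (with negation in preconditions and goals), with actions named by `Act`. -/
structure FONDProblem (Atom Act : Type*) where
  /-- the initial state: the set of atoms that are initially true -/
  init : Set Atom
  action : Act → FONDAction Atom
  goal : Set (Lit Atom)

namespace FONDProblem

variable {Atom Act : Type*} (P : FONDProblem Atom Act)

/-- `s` is a goal state. -/
def IsGoal (s : Set Atom) : Prop := ∀ l ∈ P.goal, l.Holds s

/-- The set `F(a, s)` of the successors of `s` under `a`: it is empty if the preconditions of `a`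
fail in `s`; otherwise one alternative is selected from each non-deterministic effect. -/
def succ (a : Act) (s : Set Atom) : Set (Set Atom) :=
  {s' | (∀ l ∈ (P.action a).pre, l.Holds s) ∧
    ∃ c : Set (Set (Lit Atom)) → Set (Lit Atom),
      (∀ o ∈ (P.action a).oneofs, c o ∈ o) ∧
      s' = applyEffects ((P.action a).det ∪ ⋃ o ∈ (P.action a).oneofs, c o) s}

/-- A policy is a partial function from non-goal states to actions
(`none` means that no action is prescribed). -/
def IsPolicy (π : Set Atom → Option Act) : Prop := ∀ s, P.IsGoal s → π s = none

/-- The transitions `(s, s')` with `s' ∈ F(π(s), s)`. -/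
def Edge (π : Set Atom → Option Act) (s s' : Set Atom) : Prop :=
  ∃ a, π s = some a ∧ s' ∈ P.succ a s

/-- `τ 0, …, τ n` is a finite `π`-trajectory. -/
def IsTrajectory (π : Set Atom → Option Act) (n : ℕ) (τ : ℕ → Set Atom) : Prop :=
  τ 0 = P.init ∧ ∀ i < n, P.Edge π (τ i) (τ (i + 1))

/-- `π` reaches the state `s`. -/
def Reaches (π : Set Atom → Option Act) (s : Set Atom) : Prop :=
  ∃ n τ, P.IsTrajectory π n τ ∧ τ n = s

/-- `π` reaches the state `s'` from the state `s`. -/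
def ReachesFrom (π : Set Atom → Option Act) (s s' : Set Atom) : Prop :=
  ∃ n τ i j, P.IsTrajectory π n τ ∧ i ≤ j ∧ j ≤ n ∧ τ i = s ∧ τ j = s'

/-- `π` is a strong-cyclic solution: it reaches a goal state from any state that it reaches. -/
def IsStrongCyclic (π : Set Atom → Option Act) : Prop :=
  ∀ s, P.Reaches π s → ∃ g, P.IsGoal g ∧ P.ReachesFrom π s g

/-- `c 0, …, c n` is a cycle on `s`: a path of length at least one from `s` to itself
in the policy graph (nodes may be repeated). -/
def IsCycle (π : Set Atom → Option Act) (s : Set Atom) (n : ℕ) (c : ℕ → Set Atom) : Prop :=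
  0 < n ∧ c 0 = s ∧ c n = s ∧ ∀ i < n, P.Edge π (c i) (c (i + 1))

end FONDProblem

/-! ## Qualitative numerical planning problems -/

/-- Literals of a QNP: `p`, `¬ p` for an atom `p`, and `X = 0`, `X > 0` for a variable `X`. -/
inductive QLit (At V : Type*) where
  | pos (p : At)
  | neg (p : At)
  | eqZero (X : V)
  | gtZero (X : V)

/-- An action of a QNP. No variable is both incremented and decremented,
and `X > 0` is a precondition of every action that decrements `X`. -/
structure QNPAction (At V : Type*) where
  pre : Set (QLit At V)
  eff : Set (Lit At)
  inc : Set V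
  dec : Set V
  disjoint_inc_dec : Disjoint inc dec
  gtZero_mem_pre : ∀ X ∈ dec, QLit.gtZero X ∈ pre

/-- A QNP with atoms `At`, numerical variables `V` and actions named by `Act`. The initial situation
is a maximal consistent set of literals. -/
structure QNP (At V Act : Type*) where
  init : Set (QLit At V)
  init_atom : ∀ p, Xor (QLit.pos p ∈ init) (QLit.neg p ∈ init)
  init_var : ∀ X, Xor (QLit.eqZero X ∈ init) (QLit.gtZero X ∈ init)
  action : Act → QNPAction At V
  goal : Set (QLit At V)

/-- A (quantitative) state of a QNP: the set of true atoms, and a non-negative real value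
for each numerical variable. -/
structure NumState (At V : Type*) where
  atoms : Set At
  val : V → NNReal

namespace NumState

variable {At V : Type*}

/-- Truth of a QNP literal in a quantitative state. -/
def Sat (s : NumState At V) : QLit At V → Prop
  | .pos p => p ∈ s.atoms
  | .neg p => p ∉ s.atoms
  | .eqZero X => s.val X = 0
  | .gtZero X => 0 < s.val X

/-- The qualitative state of `s`: the truth values of the atoms `p` (`Sum.inl p`)
and of the expressions `X = 0` (`Sum.inr X`). -/
def qual (s : NumState At V) : Set (At ⊕ V) :=
  {z | Sum.elim (fun p => p ∈ s.atoms) (fun X => s.val X = 0) z}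

end NumState

namespace QNP

variable {At V Act : Type*} (Q : QNP At V Act)

def IsInit (s : NumState At V) : Prop := ∀ l ∈ Q.init, s.Sat l

def IsGoal (s : NumState At V) : Prop := ∀ l ∈ Q.goal, s.Sat l

def Applicable (a : Act) (s : NumState At V) : Prop := ∀ l ∈ (Q.action a).pre, s.Sat l

/-- `s'` is a possible result of doing `a` in `s`: incremented (decremented) variables change by
some positive amount, the other variables keep their value. -/
def Step (a : Act) (s s' : NumState At V) : Prop :=
  Q.Applicable a s ∧
  s'.atoms = applyEffects (Q.action a).eff s.atoms ∧
  (∀ X ∈ (Q.action a).inc, s.val X < s'.val X) ∧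
  (∀ X ∈ (Q.action a).dec, s'.val X < s.val X) ∧
  (∀ X, X ∉ (Q.action a).inc → X ∉ (Q.action a).dec → s'.val X = s.val X)

/-- The changes from `s` to `s'` under `a` are by at least `ε`, except that
a variable may also be decremented to `0` by less than `ε`. -/
def EpsBounded (ε : NNReal) (a : Act) (s s' : NumState At V) : Prop :=
  (∀ X ∈ (Q.action a).inc, s.val X + ε ≤ s'.val X) ∧
  (∀ X ∈ (Q.action a).dec, s'.val X + ε ≤ s.val X ∨ s'.val X = 0)

/-- `τ 0, τ 1, …` (up to `τ N` if `N` is finite) is an `ε`-bounded trajectory of `Q` that is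
compatible with the policy `π`, which depends on qualitative states only. -/
def IsTrajectory (π : Set (At ⊕ V) → Option Act) (ε : NNReal) (N : ℕ∞)
    (τ : ℕ → NumState At V) : Prop :=
  Q.IsInit (τ 0) ∧ ∀ i : ℕ, (i : ℕ∞) < N → ∃ a, π (τ i).qual = some a ∧
    Q.Step a (τ i) (τ (i + 1)) ∧ Q.EpsBounded ε a (τ i) (τ (i + 1))

/-- A trajectory `τ 0, τ 1, …` (up to `τ N` if `N` is finite) is maximal if it is infinite, or ends
in its first goal state, or ends in a state where the policy prescribes no action or
an action that is not applicable. -/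
def IsMaximal (π : Set (At ⊕ V) → Option Act) (N : ℕ∞) (τ : ℕ → NumState At V) : Prop :=
  N = ⊤ ∨ ∃ n : ℕ, N = n ∧
    ((Q.IsGoal (τ n) ∧ ∀ i < n, ¬ Q.IsGoal (τ i)) ∨
      π (τ n).qual = none ∨
      ∃ a, π (τ n).qual = some a ∧ ¬ Q.Applicable a (τ n))

/-- The policy `π` solves `Q`: for every `ε > 0`, all maximal `ε`-bounded trajectories that are
compatible with `π` reach a goal state. -/
def Solves (π : Set (At ⊕ V) → Option Act) : Prop :=
  ∀ ε : NNReal, 0 < ε → ∀ (N : ℕ∞) (τ : ℕ → NumState At V),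
    Q.IsTrajectory π ε N τ → Q.IsMaximal π N τ →
      ∃ i : ℕ, (i : ℕ∞) ≤ N ∧ Q.IsGoal (τ i)

end QNP

/-! ## The direct translation and termination -/

/-- The translation of literals: the atom `p_X = Sum.inr X` stands for `X = 0`. -/
def QLit.translate {At V : Type*} : QLit At V → Lit (At ⊕ V)
  | .pos p => .pos (.inl p)
  | .neg p => .neg (.inl p)
  | .eqZero X => .pos (.inr X)
  | .gtZero X => .neg (.inr X)

/-- Boolean effects as effects over the atoms of the translation. -/
def Lit.translate {At V : Type*} : Lit At → Lit (At ⊕ V)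
  | .pos p => .pos (.inl p)
  | .neg p => .neg (.inl p)

/-- The non-deterministic effect `oneof(z, ¬ z)`. -/
def oneofAtom {Atom : Type*} (z : Atom) : Set (Set (Lit Atom)) := {{Lit.pos z}, {Lit.neg z}}

/-- An increment of `X` becomes `¬ p_X` and a decrement of `X` becomes `oneof(p_X, ¬ p_X)`. -/
def QNPAction.translate {At V : Type*} (a : QNPAction At V) : FONDAction (At ⊕ V) where
  pre := QLit.translate '' a.pre
  det := Lit.translate '' a.eff ∪ {l | ∃ X ∈ a.inc, l = Lit.neg (Sum.inr X)}
  oneofs := {o | ∃ X ∈ a.dec, o = oneofAtom (Sum.inr X)}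

/-- The direct translation `T_D(Q)` of a QNP `Q` into a FOND problem. -/
def QNP.directTranslation {At V Act : Type*} (Q : QNP At V Act) : FONDProblem (At ⊕ V) Act where
  init := {z | Lit.pos z ∈ QLit.translate '' Q.init}
  action := fun a => (Q.action a).translate
  goal := QLit.translate '' Q.goal

namespace FONDProblem

variable {At V Act : Type*} (P : FONDProblem (At ⊕ V) Act)

/-- `π(s)` increments `X`, that is, has the effect `¬ p_X`. -/
def Increments (π : Set (At ⊕ V) → Option Act) (s : Set (At ⊕ V)) (X : V) : Prop :=
  ∃ a, π s = some a ∧ Lit.neg (Sum.inr X) ∈ (P.action a).det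

/-- `π(s)` decrements `X`, that is, has the effect `oneof(p_X, ¬ p_X)`. -/
def Decrements (π : Set (At ⊕ V) → Option Act) (s : Set (At ⊕ V)) (X : V) : Prop :=
  ∃ a, π s = some a ∧ oneofAtom (Sum.inr X) ∈ (P.action a).oneofs

/-- The three clauses by which `s` terminates, when the states in `T` are known to terminate. -/
def TerminationClause (π : Set (At ⊕ V) → Option Act) (T : Set (Set (At ⊕ V)))
    (s : Set (At ⊕ V)) : Prop :=
  (¬ ∃ n c, P.IsCycle π s n c) ∨
  (∀ n c, P.IsCycle π s n c → ∃ i ≤ n, c i ∈ T) ∨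
  (∃ X, P.Decrements π s X ∧
    ∀ n c, P.IsCycle π s n c → (∃ i ≤ n, P.Increments π (c i) X) → ∃ j ≤ n, c j ∈ T)

/-- `s` terminates: the predicate inductively defined by the three clauses, that is,
`s` belongs to the least set of states that is closed under them. -/
def StateTerminates (π : Set (At ⊕ V) → Option Act) (s : Set (At ⊕ V)) : Prop :=
  ∀ T : Set (Set (At ⊕ V)), (∀ t, P.TerminationClause π T t → t ∈ T) → s ∈ T

/-- The policy `π` terminates: every state that it reaches terminates. -/
def Terminates (π : Set (At ⊕ V) → Option Act) : Prop :=
  ∀ s, P.Reaches π s → P.StateTerminates π s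

end FONDProblem

/-!
Quantitative states project to qualitative ones, and every transition of the QNP projects to an edge
of the policy graph of its direct translation (`QNP.Step.qual_mem_succ`). The question is therefore
which paths of the policy graph lift to `ε`-bounded trajectories.

*From the translation to the QNP.* A finite maximal trajectory which misses the goal ends in a
reachable dead end, which a strong-cyclic policy does not have. Along an infinite `ε`-bounded
trajectory, no state that recurs infinitely often terminates
(`QNP.IsTrajectory.not_stateTerminates_of_frequently`):
eventually only recurring states occur, so the first two clauses fail for want of a terminating
state on some cycle, and the third one would give a variable which is decremented infinitely often
and eventually never incremented, contradicting `ε`-boundedness. As there are finitely many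
qualitative states, some state recurs.

*From the QNP to the translation.* A path of the policy graph lifts to a `1`-bounded trajectory as
soon as every variable that is decremented infinitely often is incremented infinitely often
(`QNP.exists_trajectory`): since increments may be as large as one likes, a variable can be raised
at each increment by enough to pay for all the decrements before the next one
(`exists_potential`). If no goal were reachable from a reachable state, then either a dead end or
the infinite path on which every decrement yields zero would lift, since on the latter a variable
has to be incremented between two decrements. If some reachable state did not terminate, consider,
among the cycles on it that consist of nonterminating states, one that visits a largest set of
states. Failure of the third clause at a state of the cycle gives a further cycle of nonterminating
states through an increment; splicing it in shows, by maximality, that the increment already occurs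
on the cycle (`FONDProblem.exists_fair_cycle`). Repeating that cycle forever gives a path that lifts.
-/

open Filter

/-! ### Potentials -/

/-- If `dec` happens finitely often or `inc` happens infinitely often, there is a natural-valued
quantity that goes up at each `inc`, goes down at each `dec`, and is constant otherwise. -/
theorem exists_potential (inc dec : ℕ → Prop) (hdisj : ∀ i, inc i → ¬ dec i)
    (hfair : (∃ᶠ i in atTop, dec i) → ∃ᶠ i in atTop, inc i) :
    ∃ r : ℕ → ℕ, (∀ i, inc i → r i + 1 ≤ r (i + 1)) ∧ (∀ i, dec i → r (i + 1) + 1 ≤ r i) ∧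
      ∀ i, ¬ inc i → ¬ dec i → r (i + 1) = r i := by
  classical
  -- The decrements at or after `i` that precede the next increment.
  let D : ℕ → Set ℕ := fun i => {k | i ≤ k ∧ dec k ∧ ∀ j, i ≤ j → j ≤ k → ¬ inc j}
  have hfin : ∀ i, (D i).Finite := by
    intro i
    by_cases h : ∃ᶠ k in atTop, dec k
    · obtain ⟨b, hib, hb⟩ := (frequently_atTop.1 (hfair h)) i
      refine (Set.finite_Iio b).subset fun k hk => ?_
      by_contra hlt
      exact hk.2.2 b hib (not_lt.1 hlt) hb
    · rw [not_frequently, eventually_atTop] at h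
      obtain ⟨b, hb⟩ := h
      refine (Set.finite_Iio b).subset fun k hk => ?_
      by_contra hlt
      exact hb k (not_lt.1 hlt) hk.2.1
  -- Adding the number of past increments makes up for the case that no decrement follows.
  refine ⟨fun i => Nat.count inc i + (D i).ncard, fun i hi => ?_, fun i hi => ?_,
    fun i hi hd => ?_⟩
  · have hD : D i = ∅ := by
      ext k
      simp only [D, Set.mem_ofPred_eq, Set.mem_empty_iff_false, iff_false]
      rintro ⟨hik, -, h⟩
      exact h i le_rfl hik hi
    simp [hD, Nat.count_succ, hi]
  · have hni : ¬ inc i := fun h => hdisj i h hi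
    have hD : D i = insert i (D (i + 1)) := by
      ext k
      simp only [D, Set.mem_ofPred_eq, Set.mem_insert_iff]
      constructor
      · rintro ⟨hik, hk, h⟩
        rcases hik.eq_or_lt with rfl | hlt
        · exact Or.inl rfl
        · exact Or.inr ⟨hlt, hk, fun j hj => h j (by omega)⟩
      · rintro (rfl | ⟨hik, hk, h⟩)
        · refine ⟨le_rfl, hi, fun j h1 h2 => ?_⟩
          rwa [le_antisymm h2 h1]
        · refine ⟨by omega, hk, fun j h1 h2 => ?_⟩
          rcases h1.eq_or_lt with rfl | hlt
          · exact hni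
          · exact h j hlt h2
    have hnot : i ∉ D (i + 1) := fun h => by
      have := h.1
      omega
    simp [hD, Nat.count_succ, hni, Set.ncard_insert_of_notMem hnot (hfin _), add_assoc]
  · have hD : D i = D (i + 1) := by
      ext k
      simp only [D, Set.mem_ofPred_eq]
      constructor
      · rintro ⟨hik, hk, h⟩
        rcases hik.eq_or_lt with rfl | hlt
        · exact absurd hk hd
        · exact ⟨hlt, hk, fun j hj => h j (by omega)⟩
      · rintro ⟨hik, hk, h⟩
        refine ⟨by omega, hk, fun j h1 h2 => ?_⟩
        rcases h1.eq_or_lt with rfl | hlt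
        · exact hi
        · exact h j hlt h2
    simp [hD, Nat.count_succ, hi]

/-! ### Walks and the states they visit -/

/-- `VisitingWalk E a b S`: there is a walk of positive length from `a` to `b` along `E` such that
`S` is the set of the nodes on it, not counting its last node. On a closed walk the last
node is also the first one, so that `S` is the set of all its nodes. -/
inductive VisitingWalk {α : Type*} (E : α → α → Prop) : α → α → Set α → Prop
  | single {a b : α} : E a b → VisitingWalk E a b {a}
  | cons {a b c : α} {S : Set α} : E a b → VisitingWalk E b c S → VisitingWalk E a c (insert a S)

namespace VisitingWalk

variable {α : Type*} {E : α → α → Prop}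

theorem trans {a b c : α} {S S' : Set α} (h : VisitingWalk E a b S)
    (h' : VisitingWalk E b c S') : VisitingWalk E a c (S ∪ S') := by
  induction h with
  | single e => exact cons e h'
  | cons e _ ih =>
    rw [Set.insert_union]
    exact cons e (ih h')

theorem split {a b t : α} {S : Set α} (h : VisitingWalk E a b S) (ht : t ∈ S) :
    t = a ∨ ∃ S₁ S₂, VisitingWalk E a t S₁ ∧ VisitingWalk E t b S₂ ∧ S = S₁ ∪ S₂ := by
  induction h with
  | single e => exact Or.inl ht
  | @cons a b c S e h ih =>
    rcases ht with rfl | ht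
    · exact Or.inl rfl
    · right
      rcases ih ht with rfl | ⟨S₁, S₂, h₁, h₂, rfl⟩
      · exact ⟨{a}, S, single e, h, rfl⟩
      · exact ⟨insert a S₁, S₂, cons e h₁, h₂, (Set.insert_union ..).symm⟩

/-- A cycle on a node of a closed walk can be inserted into that walk. -/
theorem splice {a t : α} {S S' : Set α} (h : VisitingWalk E a a S) (ht : t ∈ S)
    (h' : VisitingWalk E t t S') : VisitingWalk E a a (S ∪ S') := by
  rcases h.split ht with rfl | ⟨S₁, S₂, h₁, h₂, rfl⟩
  · exact h.trans h'
  · have := (h₁.trans h').trans h₂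
    rwa [Set.union_right_comm] at this

theorem of_path (n : ℕ) (c : ℕ → α) (h : ∀ i < n + 1, E (c i) (c (i + 1))) :
    VisitingWalk E (c 0) (c (n + 1)) (c '' Set.Iio (n + 1)) := by
  induction n generalizing c with
  | zero =>
    have : c '' Set.Iio (0 + 1) = {c 0} := by
      ext x
      simp
    rw [this]
    exact single (h 0 (by omega))
  | succ n ih =>
    have key := cons (h 0 (by omega)) (ih (fun i => c (i + 1)) fun i hi => h (i + 1) (by omega))
    convert key using 1
    ext x
    simp only [Set.mem_image, Set.mem_Iio, Set.mem_insert_iff]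
    constructor
    · rintro ⟨i, hi, rfl⟩
      cases i with
      | zero => exact Or.inl rfl
      | succ i => exact Or.inr ⟨i, by omega, rfl⟩
    · rintro (rfl | ⟨i, hi, rfl⟩)
      · exact ⟨0, by omega, rfl⟩
      · exact ⟨i + 1, by omega, rfl⟩

theorem exists_path {a b : α} {S : Set α} (h : VisitingWalk E a b S) :
    ∃ (n : ℕ) (c : ℕ → α), 0 < n ∧ c 0 = a ∧ c n = b ∧ (∀ i < n, E (c i) (c (i + 1))) ∧
      S = c '' Set.Iio n := by
  induction h with
  | @single a b e =>
    refine ⟨1, fun i => if i = 0 then a else b, by omega, rfl, rfl, fun i hi => ?_, ?_⟩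
    · obtain rfl : i = 0 := by omega
      simpa using e
    · ext x
      simp [eq_comm]
  | @cons a b d S e _ ih =>
    obtain ⟨n, c, hn, h0, hn', hE, rfl⟩ := ih
    refine ⟨n + 1, fun i => Nat.casesOn i a c, by omega, rfl, hn', fun i hi => ?_, ?_⟩
    · cases i with
      | zero => simpa [h0] using e
      | succ i => exact hE i (by omega)
    · ext x
      simp only [Set.mem_image, Set.mem_Iio, Set.mem_insert_iff]
      constructor
      · rintro (rfl | ⟨i, hi, rfl⟩)
        · exact ⟨0, by omega, rfl⟩
        · exact ⟨i + 1, by omega, rfl⟩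
      · rintro ⟨i, hi, rfl⟩
        cases i with
        | zero => exact Or.inl rfl
        | succ i => exact Or.inr ⟨i, by omega, rfl⟩

end VisitingWalk

/-! ### Reachability in the policy graph -/

namespace FONDProblem

section

variable {Atom Act : Type*} {P : FONDProblem Atom Act} {π : Set Atom → Option Act}

theorem IsTrajectory.extend {n : ℕ} {τ : ℕ → Set Atom} (h : P.IsTrajectory π n τ) {t : Set Atom}
    (ht : Relation.ReflTransGen (P.Edge π) (τ n) t) :
    ∃ m σ, n ≤ m ∧ P.IsTrajectory π m σ ∧ σ n = τ n ∧ σ m = t := by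
  induction ht with
  | refl => exact ⟨n, τ, le_rfl, h, rfl, rfl⟩
  | @tail b c _ e ih =>
    obtain ⟨m, σ, hnm, hσ, h1, h2⟩ := ih
    refine ⟨m + 1, fun i => if i ≤ m then σ i else c, by omega, ⟨by simpa using hσ.1, ?_⟩,
      by simpa [hnm] using h1, by simp⟩
    intro i hi
    rcases (Nat.lt_succ_iff.1 hi).eq_or_lt with rfl | hlt
    · simpa [h2] using e
    · simpa [hlt.le, Nat.succ_le_of_lt hlt] using hσ.2 i hlt

theorem Reaches.reachesFrom {s t : Set Atom} (hs : P.Reaches π s)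
    (ht : Relation.ReflTransGen (P.Edge π) s t) : P.ReachesFrom π s t := by
  obtain ⟨n, τ, hτ, rfl⟩ := hs
  obtain ⟨m, σ, hnm, hσ, h1, h2⟩ := hτ.extend ht
  exact ⟨m, σ, n, m, hσ, hnm, le_rfl, h1, h2⟩

theorem Reaches.trans {s t : Set Atom} (hs : P.Reaches π s)
    (ht : Relation.ReflTransGen (P.Edge π) s t) : P.Reaches π t := by
  obtain ⟨n, τ, hτ, rfl⟩ := hs
  obtain ⟨m, σ, -, hσ, -, h2⟩ := hτ.extend ht
  exact ⟨m, σ, hσ, h2⟩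

theorem IsPolicy.not_isGoal_of_edge (hπ : P.IsPolicy π) {s s' : Set Atom} (h : P.Edge π s s') :
    ¬ P.IsGoal s := by
  intro hg
  obtain ⟨a, ha, -⟩ := h
  simp [hπ s hg] at ha

/-- A strong-cyclic policy has no reachable dead end apart from the goal states. -/
theorem IsStrongCyclic.exists_edge (h : P.IsStrongCyclic π) {s : Set Atom} (hs : P.Reaches π s)
    (hg : ¬ P.IsGoal s) : ∃ s', P.Edge π s s' := by
  obtain ⟨g, hgoal, n, τ, i, j, hτ, hij, hjn, rfl, rfl⟩ := h s hs
  rcases hij.eq_or_lt with rfl | hlt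
  · exact absurd hgoal hg
  · exact ⟨_, hτ.2 i (by omega)⟩

end

/-! ### Termination -/

section

variable {At V Act : Type*} {P : FONDProblem (At ⊕ V) Act} {π : Set (At ⊕ V) → Option Act}

theorem TerminationClause.mono {T T' : Set (Set (At ⊕ V))} (hT : T ⊆ T') {s : Set (At ⊕ V)}
    (h : P.TerminationClause π T s) : P.TerminationClause π T' s := by
  rcases h with h | h | ⟨X, hX, h⟩
  · exact Or.inl h
  · exact Or.inr (Or.inl fun n c hc => (h n c hc).imp fun i hi => ⟨hi.1, hT hi.2⟩)
  · exact Or.inr (Or.inr ⟨X, hX, fun n c hc hi => (h n c hc hi).imp fun i hi => ⟨hi.1, hT hi.2⟩⟩)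

theorem stateTerminates_of_clause {s : Set (At ⊕ V)}
    (h : P.TerminationClause π {t | P.StateTerminates π t} s) : P.StateTerminates π s :=
  fun T hT => hT s (h.mono fun t (ht : P.StateTerminates π t) => ht T hT)

/-- A cycle that avoids `T` is a closed walk all of whose edges have their source outside `T`. -/
theorem IsCycle.visitingWalk {s : Set (At ⊕ V)} {n : ℕ} {c : ℕ → Set (At ⊕ V)}
    (h : P.IsCycle π s n c) {T : Set (Set (At ⊕ V))} (hT : ∀ i ≤ n, c i ∉ T) :
    VisitingWalk (fun t t' => t ∉ T ∧ P.Edge π t t') s s (c '' Set.Iio n) := by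
  obtain ⟨hn, h0, hn', hE⟩ := h
  obtain ⟨n, rfl⟩ : ∃ k, n = k + 1 := ⟨n - 1, by omega⟩
  have := VisitingWalk.of_path (E := fun t t' => t ∉ T ∧ P.Edge π t t') n c
    fun i hi => ⟨hT i hi.le, hE i hi⟩
  rwa [h0, hn'] at this

/-- On a nonterminating state there is a cycle on which each decremented variable is also
incremented. -/
theorem exists_fair_cycle [Finite At] [Finite V] {s : Set (At ⊕ V)}
    (hs : ¬ P.StateTerminates π s) :
    ∃ n c, P.IsCycle π s n c ∧
      ∀ X, ∀ i < n, P.Decrements π (c i) X → ∃ j < n, P.Increments π (c j) X := by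
  set T : Set (Set (At ⊕ V)) := {t | P.StateTerminates π t} with hTdef
  set E : Set (At ⊕ V) → Set (At ⊕ V) → Prop := fun t t' => t ∉ T ∧ P.Edge π t t' with hEdef
  have hclause : ∀ t ∉ T, ¬ P.TerminationClause π T t :=
    fun t ht h => ht (stateTerminates_of_clause h)
  have hne : {S | VisitingWalk E s s S}.Nonempty := by
    have h := hclause s hs
    simp only [TerminationClause, not_or, not_forall, not_exists, not_and] at h
    obtain ⟨-, ⟨n, c, hc, hcT⟩, -⟩ := h
    exact ⟨_, hc.visitingWalk hcT⟩
  obtain ⟨M, hM⟩ := (Set.toFinite {S | VisitingWalk E s s S}).exists_maximal hne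
  have hMw : VisitingWalk E s s M := hM.prop
  obtain ⟨n, c, hn, h0, hcn, hE, hMc⟩ := hMw.exists_path
  refine ⟨n, c, ⟨hn, h0, hcn, fun i hi => (hE i hi).2⟩, fun X i hi hdec => ?_⟩
  have h := hclause (c i) (hE i hi).1
  simp only [TerminationClause, not_or, not_exists, not_and] at h
  have h3 := h.2.2 X hdec
  push Not at h3
  obtain ⟨k, d, hd, ⟨j, hj, hinc⟩, hdT⟩ := h3
  have hsub := hM.le_of_ge (hMw.splice (t := c i) (hMc ▸ ⟨i, hi, rfl⟩) (hd.visitingWalk hdT))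
    Set.subset_union_left
  -- The last node of the inserted cycle is its first one.
  obtain ⟨j', hj', hjj⟩ : ∃ j' < k, d j' = d j := by
    rcases hj.eq_or_lt with rfl | hlt
    · exact ⟨0, hd.1, hd.2.1.trans hd.2.2.1.symm⟩
    · exact ⟨j, hlt, rfl⟩
  have hmem : d j ∈ M := hsub (Or.inr ⟨j', hj', hjj⟩)
  rw [hMc] at hmem
  obtain ⟨l, hl, hlj⟩ := hmem
  exact ⟨l, hl, by rwa [hlj]⟩

end

end FONDProblem

/-! ### Qualitative states and the direct translation -/

namespace NumState

variable {At V : Type*}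

@[simp] theorem inl_mem_qual {s : NumState At V} {p : At} : Sum.inl p ∈ s.qual ↔ p ∈ s.atoms :=
  Iff.rfl

@[simp] theorem inr_mem_qual {s : NumState At V} {X : V} : Sum.inr X ∈ s.qual ↔ s.val X = 0 :=
  Iff.rfl

theorem holds_translate_qual {s : NumState At V} {l : QLit At V} :
    l.translate.Holds s.qual ↔ s.Sat l := by
  cases l <;> simp [QLit.translate, Lit.Holds, Sat, pos_iff_ne_zero]

end NumState

theorem oneofAtom_injective {Atom : Type*} : Function.Injective (oneofAtom (Atom := Atom)) := by
  intro z z' h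
  have hz : ({Lit.pos z} : Set (Lit Atom)) ∈ oneofAtom z' := h ▸ Or.inl rfl
  simpa [oneofAtom] using hz

namespace QNP

variable {At V Act : Type*} {Q : QNP At V Act} {π : Set (At ⊕ V) → Option Act}

theorem isGoal_qual {s : NumState At V} : Q.directTranslation.IsGoal s.qual ↔ Q.IsGoal s := by
  simp [FONDProblem.IsGoal, IsGoal, directTranslation, NumState.holds_translate_qual]

theorem isInit_iff {s : NumState At V} : Q.IsInit s ↔ s.qual = Q.directTranslation.init := by
  have hp : ∀ p : At, Sum.inl p ∈ Q.directTranslation.init ↔ QLit.pos p ∈ Q.init := by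
    intro p
    constructor
    · rintro ⟨l, hl, h⟩
      cases l <;> simp [QLit.translate] at h
      exact h ▸ hl
    · exact fun h => ⟨_, h, rfl⟩
  have hX : ∀ X : V, Sum.inr X ∈ Q.directTranslation.init ↔ QLit.eqZero X ∈ Q.init := by
    intro X
    constructor
    · rintro ⟨l, hl, h⟩
      cases l <;> simp [QLit.translate] at h
      exact h ▸ hl
    · exact fun h => ⟨_, h, rfl⟩
  constructor
  · intro h
    ext (p | X)
    · rw [hp, NumState.inl_mem_qual]
      rcases Q.init_atom p with ⟨h1, h2⟩ | ⟨h1, h2⟩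
      · exact iff_of_true (h _ h1) h1
      · exact iff_of_false (h _ h1) h2
    · rw [hX, NumState.inr_mem_qual]
      rcases Q.init_var X with ⟨h1, h2⟩ | ⟨h1, h2⟩
      · exact iff_of_true (h _ h1) h1
      · exact iff_of_false (ne_of_gt (h _ h1)) h2
  · intro h l hl
    cases l with
    | pos p => rwa [NumState.Sat, ← NumState.inl_mem_qual, h, hp]
    | neg p =>
      rw [NumState.Sat, ← NumState.inl_mem_qual, h, hp]
      rcases Q.init_atom p with ⟨h1, h2⟩ | ⟨h1, h2⟩
      · exact absurd hl h2
      · exact h2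
    | eqZero X => rwa [NumState.Sat, ← NumState.inr_mem_qual, h, hX]
    | gtZero X =>
      rw [NumState.Sat, pos_iff_ne_zero, Ne, ← NumState.inr_mem_qual, h, hX]
      rcases Q.init_var X with ⟨h1, h2⟩ | ⟨h1, h2⟩
      · exact absurd hl h2
      · exact h2

theorem increments_iff {s : Set (At ⊕ V)} {X : V} :
    Q.directTranslation.Increments π s X ↔ ∃ a, π s = some a ∧ X ∈ (Q.action a).inc := by
  refine exists_congr fun a => and_congr_right fun _ => ?_
  constructor
  · rintro (⟨l, -, h⟩ | ⟨Y, hY, h⟩)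
    · cases l <;> simp [Lit.translate] at h
    · simp only [Lit.neg.injEq, Sum.inr.injEq] at h
      exact h ▸ hY
  · exact fun h => Or.inr ⟨X, h, rfl⟩

theorem decrements_iff {s : Set (At ⊕ V)} {X : V} :
    Q.directTranslation.Decrements π s X ↔ ∃ a, π s = some a ∧ X ∈ (Q.action a).dec := by
  refine exists_congr fun a => and_congr_right fun _ => ?_
  constructor
  · rintro ⟨Y, hY, h⟩
    exact Sum.inr_injective (oneofAtom_injective h) ▸ hY
  · exact fun h => ⟨X, h, rfl⟩

/-- The successors of a state under a translated action, described atom by atom: the atoms `p_X` of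
the decremented variables `X` are unconstrained. -/
theorem mem_succ_iff {a : Act} {s s' : Set (At ⊕ V)} :
    s' ∈ Q.directTranslation.succ a s ↔
      (∀ l ∈ (Q.action a).pre, l.translate.Holds s) ∧
      (∀ p, Sum.inl p ∈ s' ↔ p ∈ applyEffects (Q.action a).eff (Sum.inl ⁻¹' s)) ∧
      (∀ X ∈ (Q.action a).inc, Sum.inr X ∉ s') ∧
      ∀ X, X ∉ (Q.action a).inc → X ∉ (Q.action a).dec → (Sum.inr X ∈ s' ↔ Sum.inr X ∈ s) := by
  have hpre : (∀ l ∈ (Q.directTranslation.action a).pre, l.Holds s) ↔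
      ∀ l ∈ (Q.action a).pre, l.translate.Holds s := by
    simp [directTranslation, QNPAction.translate]
  have hU : ∀ (c : Set (Set (Lit (At ⊕ V))) → Set (Lit (At ⊕ V))) (l : Lit (At ⊕ V)),
      l ∈ (⋃ o ∈ (Q.directTranslation.action a).oneofs, c o) ↔
        ∃ X ∈ (Q.action a).dec, l ∈ c (oneofAtom (Sum.inr X)) := by
    intro c l
    simp only [directTranslation, QNPAction.translate, Set.mem_iUnion, Set.mem_ofPred_eq,
      exists_prop]
    constructor
    · rintro ⟨_, ⟨X, hX, rfl⟩, h⟩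
      exact ⟨X, hX, h⟩
    · rintro ⟨X, hX, h⟩
      exact ⟨_, ⟨X, hX, rfl⟩, h⟩
  have hdet : ∀ l, l ∈ (Q.directTranslation.action a).det ↔
      (∃ k ∈ (Q.action a).eff, k.translate = l) ∨
        ∃ X ∈ (Q.action a).inc, l = Lit.neg (Sum.inr X) := fun l => Iff.rfl
  have hpos : ∀ k : Lit At, ∀ p : At,
      (k.translate : Lit (At ⊕ V)) = Lit.pos (Sum.inl p) ↔ k = Lit.pos p := by
    rintro (q | q) p <;> simp [Lit.translate]
  have hneg : ∀ k : Lit At, ∀ p : At,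
      (k.translate : Lit (At ⊕ V)) = Lit.neg (Sum.inl p) ↔ k = Lit.neg p := by
    rintro (q | q) p <;> simp [Lit.translate]
  have hpos' : ∀ k : Lit At, ∀ X : V, k.translate ≠ Lit.pos (Sum.inr X) := by
    rintro (q | q) p <;> simp [Lit.translate]
  have hneg' : ∀ k : Lit At, ∀ X : V, k.translate ≠ Lit.neg (Sum.inr X) := by
    rintro (q | q) p <;> simp [Lit.translate]
  -- All effects at once, for a given choice among the alternatives.
  have hmem : ∀ c : Set (Set (Lit (At ⊕ V))) → Set (Lit (At ⊕ V)),
      (∀ X ∈ (Q.action a).dec, c (oneofAtom (Sum.inr X)) ∈ oneofAtom (Sum.inr X)) →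
      ∀ z, (z ∈ applyEffects ((Q.directTranslation.action a).det ∪
        ⋃ o ∈ (Q.directTranslation.action a).oneofs, c o) s ↔
          Sum.elim (fun p => p ∈ applyEffects (Q.action a).eff (Sum.inl ⁻¹' s))
            (fun X => (X ∈ (Q.action a).dec ∧ Lit.pos z ∈ c (oneofAtom z)) ∨
              (Sum.inr X ∈ s ∧ X ∉ (Q.action a).inc ∧
                ¬ (X ∈ (Q.action a).dec ∧ Lit.neg z ∈ c (oneofAtom z)))) z) := by
    intro c hc z
    have hP : (∃ X ∈ (Q.action a).dec, Lit.pos z ∈ c (oneofAtom (Sum.inr X))) ↔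
        ∃ X ∈ (Q.action a).dec, z = Sum.inr X ∧ Lit.pos z ∈ c (oneofAtom z) := by
      refine exists_congr fun X => and_congr_right fun hX => ?_
      rcases hc X hX with h | h <;> constructor
      · intro h'
        have : z = Sum.inr X := by simpa [h] using h'
        exact ⟨this, this ▸ h'⟩
      · rintro ⟨rfl, h'⟩
        exact h'
      · intro h'
        rw [h] at h'
        simp at h'
      · rintro ⟨rfl, h'⟩
        exact h'
    have hN : (∃ X ∈ (Q.action a).dec, Lit.neg z ∈ c (oneofAtom (Sum.inr X))) ↔
        ∃ X ∈ (Q.action a).dec, z = Sum.inr X ∧ Lit.neg z ∈ c (oneofAtom z) := by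
      refine exists_congr fun X => and_congr_right fun hX => ?_
      rcases hc X hX with h | h <;> constructor
      · intro h'
        rw [h] at h'
        simp at h'
      · rintro ⟨rfl, h'⟩
        exact h'
      · intro h'
        rw [Set.mem_singleton_iff.1 h] at h'
        have : z = Sum.inr X := by simpa using h'
        subst this
        exact ⟨rfl, by rw [Set.mem_singleton_iff.1 h]; rfl⟩
      · rintro ⟨rfl, h'⟩
        exact h'
    simp only [applyEffects, Set.mem_ofPred_eq, Set.mem_union, hU, hdet, hP, hN]
    rcases z with p | X
    · simp [hpos, hneg]
    · simp [hpos', hneg']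
  rw [FONDProblem.succ, Set.mem_ofPred_eq, hpre]
  refine and_congr_right fun _ => ?_
  constructor
  · rintro ⟨c, hc, rfl⟩
    have hc' := fun X (hX : X ∈ (Q.action a).dec) => hc (oneofAtom (Sum.inr X)) ⟨X, hX, rfl⟩
    refine ⟨fun p => hmem c hc' _, fun X hX h => ?_, fun X hi hd => ?_⟩
    · have hd : X ∉ (Q.action a).dec := Set.disjoint_left.1 (Q.action a).disjoint_inc_dec hX
      simpa [hX, hd] using (hmem c hc' _).1 h
    · simpa [hi, hd] using hmem c hc' (Sum.inr X)
  · rintro ⟨h1, h2, h3⟩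
    -- Select from each `oneof` the literals that are true in the target state.
    have hval : ∀ z : At ⊕ V, {l | l ∈ ⋃₀ oneofAtom z ∧ l.Holds s'} ∈ oneofAtom z := by
      intro z
      by_cases hz : z ∈ s'
      · left
        ext l
        cases l <;> simp +contextual [oneofAtom, Lit.Holds, hz]
      · right
        rw [Set.mem_singleton_iff]
        ext l
        cases l <;> simp +contextual [oneofAtom, Lit.Holds, hz]
    refine ⟨fun o => {l | l ∈ ⋃₀ o ∧ l.Holds s'}, ?_, ?_⟩
    · rintro _ ⟨X, -, rfl⟩
      exact hval _
    · ext z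
      rw [hmem _ fun X _ => hval _]
      rcases z with p | X
      · exact h1 p
      · have hi := h2 X
        have hni := h3 X
        have hd := fun h : X ∈ (Q.action a).dec => fun h' =>
          Set.disjoint_left.1 (Q.action a).disjoint_inc_dec h' h
        simp only [Sum.elim_inr, oneofAtom, Lit.Holds, Set.mem_ofPred_eq]
        simp
        tauto

theorem Step.qual_mem_succ {a : Act} {s s' : NumState At V} (h : Q.Step a s s') :
    s'.qual ∈ Q.directTranslation.succ a s.qual := by
  obtain ⟨hpre, hat, hinc, -, hrest⟩ := h
  refine mem_succ_iff.2 ⟨fun l hl => NumState.holds_translate_qual.2 (hpre l hl), fun p => ?_,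
    fun X hX => ?_, fun X hi hd => ?_⟩
  · rw [NumState.inl_mem_qual, hat]
    rfl
  · exact ne_of_gt (bot_lt_of_lt (hinc X hX))
  · simp [hrest X hi hd]

theorem not_inr_mem_of_decrements {s s' : Set (At ⊕ V)} {X : V}
    (h : Q.directTranslation.Edge π s s') (hX : Q.directTranslation.Decrements π s X) :
    Sum.inr X ∉ s := by
  obtain ⟨a, ha, hs⟩ := h
  obtain ⟨b, hb, hX⟩ := decrements_iff.1 hX
  obtain rfl : a = b := Option.some_injective _ (ha.symm.trans hb)
  exact (mem_succ_iff.1 hs).1 _ ((Q.action a).gtZero_mem_pre X hX)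

/-- An applicable action has a successor in which each decremented variable is zero. -/
theorem exists_edge_zeroing {s : Set (At ⊕ V)} {a : Act} (ha : π s = some a)
    (hpre : ∀ l ∈ (Q.action a).pre, l.translate.Holds s) :
    ∃ s', Q.directTranslation.Edge π s s' ∧
      ∀ X, Q.directTranslation.Decrements π s X → Sum.inr X ∈ s' := by
  refine ⟨{z | Sum.elim (fun p => p ∈ applyEffects (Q.action a).eff (Sum.inl ⁻¹' s))
    (fun X => X ∉ (Q.action a).inc ∧ (X ∈ (Q.action a).dec ∨ Sum.inr X ∈ s)) z},
    ⟨a, ha, mem_succ_iff.2 ⟨hpre, fun p => Iff.rfl, fun X hX h => h.1 hX, fun X hi hd => ?_⟩⟩,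
    fun X hX => ?_⟩
  · simp [hi, hd]
  · obtain ⟨b, hb, hX⟩ := decrements_iff.1 hX
    obtain rfl : a = b := Option.some_injective _ (ha.symm.trans hb)
    exact ⟨fun h => Set.disjoint_left.1 (Q.action a).disjoint_inc_dec h hX, Or.inl hX⟩

/-! ### Lifting paths of the policy graph to bounded trajectories -/

/-- A path of the policy graph lifts to a `1`-bounded trajectory if each variable that is
decremented infinitely often on it is incremented infinitely often. -/
theorem exists_trajectory {N : ℕ∞} {p : ℕ → Set (At ⊕ V)} (h0 : p 0 = Q.directTranslation.init)
    (hE : ∀ i : ℕ, (i : ℕ∞) < N → Q.directTranslation.Edge π (p i) (p (i + 1)))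
    (hfair : ∀ X, (∃ᶠ i : ℕ in atTop, (i : ℕ∞) < N ∧ Q.directTranslation.Decrements π (p i) X) →
      ∃ᶠ i : ℕ in atTop, (i : ℕ∞) < N ∧ Q.directTranslation.Increments π (p i) X) :
    ∃ τ : ℕ → NumState At V, Q.IsTrajectory π 1 N τ ∧ ∀ i, (τ i).qual = p i := by
  classical
  have hdisj : ∀ X, ∀ i : ℕ, ((i : ℕ∞) < N ∧ Q.directTranslation.Increments π (p i) X) →
      ¬ ((i : ℕ∞) < N ∧ Q.directTranslation.Decrements π (p i) X) := by
    rintro X i ⟨-, hi⟩ ⟨-, hd⟩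
    obtain ⟨a, ha, hi⟩ := increments_iff.1 hi
    obtain ⟨b, hb, hd⟩ := decrements_iff.1 hd
    obtain rfl : a = b := Option.some_injective _ (ha.symm.trans hb)
    exact Set.disjoint_left.1 (Q.action a).disjoint_inc_dec hi hd
  choose r hrinc hrdec hrest using fun X => exists_potential _ _ (hdisj X) (hfair X)
  let τ : ℕ → NumState At V := fun i =>
    ⟨Sum.inl ⁻¹' p i, fun X => if Sum.inr X ∈ p i then 0 else (r X i : NNReal) + 1⟩
  have hval : ∀ i X, (τ i).val X = if Sum.inr X ∈ p i then 0 else (r X i : NNReal) + 1 :=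
    fun _ _ => rfl
  have hq : ∀ i, (τ i).qual = p i := by
    intro i
    ext (z | X)
    · rfl
    · rw [NumState.inr_mem_qual, hval]
      split_ifs with h <;> simp [h]
  refine ⟨τ, ⟨isInit_iff.2 ((hq 0).trans h0), fun i hi => ?_⟩, hq⟩
  obtain ⟨a, ha, hs⟩ := hE i hi
  obtain ⟨hpre, hat, hinc, hrest'⟩ := mem_succ_iff.1 hs
  have hinc' : ∀ X ∈ (Q.action a).inc, (τ i).val X + 1 ≤ (τ (i + 1)).val X := by
    intro X hX
    have h := hrinc X i ⟨hi, increments_iff.2 ⟨a, ha, hX⟩⟩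
    rw [hval, hval, if_neg (hinc X hX)]
    have h' : (r X i : NNReal) + 1 ≤ r X (i + 1) := by exact_mod_cast h
    split_ifs
    · simp
    · gcongr
  have hdec' : ∀ X ∈ (Q.action a).dec, (τ i).val X = (r X i : NNReal) + 1 ∧
      ((τ (i + 1)).val X + 1 ≤ (τ i).val X ∨ (τ (i + 1)).val X = 0) := by
    intro X hX
    have hD : Q.directTranslation.Decrements π (p i) X := decrements_iff.2 ⟨a, ha, hX⟩
    have h := hrdec X i ⟨hi, hD⟩
    have h' : (r X (i + 1) : NNReal) + 1 ≤ r X i := by exact_mod_cast h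
    have hv : (τ i).val X = (r X i : NNReal) + 1 := by
      rw [hval, if_neg (not_inr_mem_of_decrements (hE i hi) hD)]
    refine ⟨hv, ?_⟩
    rw [hv, hval]
    split_ifs
    · exact Or.inr rfl
    · left
      gcongr
  refine ⟨a, by rw [hq, ha], ⟨fun l hl => ?_, ?_, fun X hX => ?_, fun X hX => ?_,
    fun X h1 h2 => ?_⟩, hinc', fun X hX => (hdec' X hX).2⟩
  · rw [← NumState.holds_translate_qual, hq]
    exact hpre l hl
  · ext z
    exact hat z
  · exact lt_of_lt_of_le (lt_add_one _) (hinc' X hX)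
  · obtain ⟨hv, h | h⟩ := hdec' X hX
    · exact lt_of_lt_of_le (lt_add_one _) h
    · rw [h, hv]
      positivity
  · have hI : ¬ ((i : ℕ∞) < N ∧ Q.directTranslation.Increments π (p i) X) := by
      rintro ⟨-, h⟩
      obtain ⟨b, hb, h⟩ := increments_iff.1 h
      obtain rfl : a = b := Option.some_injective _ (ha.symm.trans hb)
      exact h1 h
    have hD : ¬ ((i : ℕ∞) < N ∧ Q.directTranslation.Decrements π (p i) X) := by
      rintro ⟨-, h⟩
      obtain ⟨b, hb, h⟩ := decrements_iff.1 h
      obtain rfl : a = b := Option.some_injective _ (ha.symm.trans hb)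
      exact h2 h
    rw [hval, hval, hrest X i hI hD]
    simp only [hrest' X h1 h2]

/-! ### Policies that solve a problem -/

/-- If `π` solves `Q`, each reachable dead end of the policy graph is a goal state. -/
theorem Solves.isGoal_of_not_edge (hsol : Q.Solves π) (hπ : Q.directTranslation.IsPolicy π)
    {s : Set (At ⊕ V)} (hs : Q.directTranslation.Reaches π s)
    (hdead : ∀ s', ¬ Q.directTranslation.Edge π s s') : Q.directTranslation.IsGoal s := by
  obtain ⟨n, p, ⟨h0, hE⟩, rfl⟩ := hs
  obtain ⟨τ, hτ, hq⟩ := exists_trajectory (N := (n : ℕ∞)) h0 (fun i hi => hE i (by simpa using hi))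
    (fun X h => by
      obtain ⟨i, hi, h, -⟩ := frequently_atTop.1 h n
      exact absurd (Nat.cast_lt.1 h) (not_lt.2 hi))
  have hmax : Q.IsMaximal π n τ := by
    refine Or.inr ⟨n, rfl, Or.inr ?_⟩
    rw [hq]
    rcases ha : π (p n) with _ | a
    · exact Or.inl rfl
    · refine Or.inr ⟨a, rfl, fun happ => ?_⟩
      obtain ⟨s', hs', -⟩ := exists_edge_zeroing (Q := Q) ha fun l hl => by
        rw [← hq, NumState.holds_translate_qual]
        exact happ l hl
      exact hdead s' hs'
  obtain ⟨i, hi, hg⟩ := hsol 1 one_pos n τ hτ hmax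
  rw [← isGoal_qual, hq] at hg
  rcases (Nat.cast_le.1 hi).eq_or_lt with rfl | hlt
  · exact hg
  · exact absurd hg (hπ.not_isGoal_of_edge (hE i hlt))

/-- If `π` solves `Q`, no reachable infinite path of the policy graph increments infinitely often
each variable that it decrements infinitely often. -/
theorem Solves.not_fair_path (hsol : Q.Solves π) (hπ : Q.directTranslation.IsPolicy π)
    {q : ℕ → Set (At ⊕ V)} (hs : Q.directTranslation.Reaches π (q 0))
    (hE : ∀ i, Q.directTranslation.Edge π (q i) (q (i + 1)))
    (hfair : ∀ X, (∃ᶠ i in atTop, Q.directTranslation.Decrements π (q i) X) →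
      ∃ᶠ i in atTop, Q.directTranslation.Increments π (q i) X) : False := by
  obtain ⟨n, σ, ⟨h0, hσ⟩, hn⟩ := hs
  let p : ℕ → Set (At ⊕ V) := fun i => if i < n then σ i else q (i - n)
  have hpq : ∀ i, p (i + n) = q i := fun i => by simp [p]
  have hpσ : ∀ i ≤ n, p i = σ i := by
    intro i hi
    rcases hi.eq_or_lt with rfl | hlt
    · simp [p, hn]
    · simp [p, hlt]
  have hpE : ∀ i, Q.directTranslation.Edge π (p i) (p (i + 1)) := by
    intro i
    rcases lt_or_ge i n with hlt | hge
    · rw [hpσ i hlt.le, hpσ (i + 1) hlt]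
      exact hσ i hlt
    · obtain ⟨j, rfl⟩ := Nat.exists_eq_add_of_le' hge
      rw [add_right_comm, hpq, hpq]
      exact hE j
  have hfreq : ∀ R : Set (At ⊕ V) → Prop,
      (∃ᶠ i in atTop, R (p i)) ↔ ∃ᶠ i in atTop, R (q i) := by
    intro R
    rw [← map_add_atTop_eq_nat n, frequently_map]
    simp only [hpq]
    rw [map_add_atTop_eq_nat]
  obtain ⟨τ, hτ, hq⟩ := exists_trajectory (N := ⊤) (p := p)
    ((hpσ 0 (Nat.zero_le _)).trans h0) (fun i _ => hpE i) (fun X h => by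
      simp only [ENat.natCast_lt_top, true_and] at h ⊢
      exact (hfreq fun s => Q.directTranslation.Increments π s X).2 (hfair X ((hfreq fun s => Q.directTranslation.Decrements π s X).1 h)))
  obtain ⟨i, -, hg⟩ := hsol 1 one_pos ⊤ τ hτ (Or.inl rfl)
  rw [← isGoal_qual, hq] at hg
  exact hπ.not_isGoal_of_edge (hpE i) hg

/-- A variable that is zero stays zero along an edge that does not increment it. -/
theorem inr_mem_of_edge {s s' : Set (At ⊕ V)} {X : V} (h : Q.directTranslation.Edge π s s')
    (hX : Sum.inr X ∈ s) (hinc : ¬ Q.directTranslation.Increments π s X) : Sum.inr X ∈ s' := by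
  have hdec := fun hd => not_inr_mem_of_decrements (X := X) h hd hX
  obtain ⟨a, ha, hs⟩ := h
  exact ((mem_succ_iff.1 hs).2.2.2 X (fun h => hinc (increments_iff.2 ⟨a, ha, h⟩))
    fun h => hdec (decrements_iff.2 ⟨a, ha, h⟩)).2 hX

theorem Solves.isStrongCyclic (hsol : Q.Solves π) (hπ : Q.directTranslation.IsPolicy π) :
    Q.directTranslation.IsStrongCyclic π := by
  intro s hs
  by_contra hno
  have hnog : ∀ t, Relation.ReflTransGen (Q.directTranslation.Edge π) s t →
      ¬ Q.directTranslation.IsGoal t := fun t ht hg => hno ⟨t, hg, hs.reachesFrom ht⟩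
  have hnext : ∀ t, ∃ t', Relation.ReflTransGen (Q.directTranslation.Edge π) s t →
      Q.directTranslation.Edge π t t' ∧
        ∀ X, Q.directTranslation.Decrements π t X → Sum.inr X ∈ t' := by
    intro t
    by_cases ht : Relation.ReflTransGen (Q.directTranslation.Edge π) s t
    · have hedge : ∃ t', Q.directTranslation.Edge π t t' := by
        by_contra h
        exact hnog t ht (hsol.isGoal_of_not_edge hπ (hs.trans ht) (not_exists.1 h))
      obtain ⟨t₁, a, ha, h⟩ := hedge
      obtain ⟨t', ht'⟩ := exists_edge_zeroing (Q := Q) ha (mem_succ_iff.1 h).1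
      exact ⟨t', fun _ => ht'⟩
    · exact ⟨t, fun h => absurd h ht⟩
  choose f hf using hnext
  have hreach : ∀ i, Relation.ReflTransGen (Q.directTranslation.Edge π) s (f^[i] s) := by
    intro i
    induction i with
    | zero => exact .refl
    | succ i ih =>
      rw [Function.iterate_succ_apply']
      exact ih.tail (hf _ ih).1
  have hstep : ∀ i, Q.directTranslation.Edge π (f^[i] s) (f^[i + 1] s) ∧
      ∀ X, Q.directTranslation.Decrements π (f^[i] s) X → Sum.inr X ∈ f^[i + 1] s := by
    intro i
    rw [Function.iterate_succ_apply']
    exact hf _ (hreach i)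
  refine hsol.not_fair_path hπ (q := fun i => f^[i] s) hs (fun i => (hstep i).1) fun X hdec => ?_
  by_contra hinc
  rw [not_frequently, eventually_atTop] at hinc
  obtain ⟨b, hb⟩ := hinc
  obtain ⟨i, hi, hdi⟩ := frequently_atTop.1 hdec b
  -- After the decrement at `i` the variable is zero forever, so it is not decremented again.
  have hzero : ∀ j, i + 1 ≤ j → Sum.inr X ∈ f^[j] s := by
    intro j hj
    induction j, hj using Nat.le_induction with
    | base => exact (hstep i).2 X hdi
    | succ j hj ih => exact inr_mem_of_edge (hstep j).1 ih (hb j (by omega))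
  obtain ⟨j, hj, hdj⟩ := frequently_atTop.1 hdec (i + 1)
  exact not_inr_mem_of_decrements (hstep j).1 hdj (hzero j hj)

theorem Solves.terminates [Finite At] [Finite V] (hsol : Q.Solves π)
    (hπ : Q.directTranslation.IsPolicy π) : Q.directTranslation.Terminates π := by
  intro s hs
  by_contra hT
  obtain ⟨n, c, ⟨hn, h0, hcn, hE⟩, hfair⟩ := FONDProblem.exists_fair_cycle hT
  refine hsol.not_fair_path hπ (q := fun i => c (i % n)) (by simpa [h0] using hs) (fun i => ?_)
    fun X hdec => ?_
  · have hlt := Nat.mod_lt i hn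
    have h := hE _ hlt
    rcases (Nat.succ_le_of_lt hlt).eq_or_lt with heq | hlt'
    · rw [Nat.succ_eq_add_one] at heq
      rw [heq, hcn, ← h0] at h
      have : (i + 1) % n = 0 := by
        rw [← Nat.mod_add_mod, heq, Nat.mod_self]
      simpa only [this] using h
    · have : (i + 1) % n = i % n + 1 := by
        rw [← Nat.mod_add_mod, Nat.mod_eq_of_lt hlt']
      simpa only [this] using h
  · obtain ⟨i, hi⟩ := hdec.exists
    obtain ⟨j, hj, hinc⟩ := hfair X _ (Nat.mod_lt i hn) hi
    refine frequently_atTop.2 fun b => ⟨j + n * b, ?_, ?_⟩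
    · have := Nat.le_mul_of_pos_left b hn
      omega
    · simpa [Nat.add_mul_mod_self_left, Nat.mod_eq_of_lt hj] using hinc

/-! ### Bounded trajectories under a terminating policy -/

theorem IsTrajectory.edge {ε : NNReal} {N : ℕ∞} {τ : ℕ → NumState At V}
    (h : Q.IsTrajectory π ε N τ) {i : ℕ} (hi : (i : ℕ∞) < N) :
    Q.directTranslation.Edge π (τ i).qual (τ (i + 1)).qual := by
  obtain ⟨a, ha, hs, -⟩ := h.2 i hi
  exact ⟨a, ha, hs.qual_mem_succ⟩

theorem IsTrajectory.reaches {ε : NNReal} {N : ℕ∞} {τ : ℕ → NumState At V}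
    (h : Q.IsTrajectory π ε N τ) {i : ℕ} (hi : (i : ℕ∞) ≤ N) :
    Q.directTranslation.Reaches π (τ i).qual :=
  ⟨i, fun j => (τ j).qual, ⟨isInit_iff.1 h.1, fun _ hj =>
    h.edge (lt_of_lt_of_le (Nat.cast_lt.2 hj) hi)⟩, rfl⟩

/-- Along an infinite `ε`-bounded trajectory, a variable that is decremented infinitely often is
incremented infinitely often. -/
theorem IsTrajectory.frequently_increments {ε : NNReal} (hε : 0 < ε) {τ : ℕ → NumState At V}
    (h : Q.IsTrajectory π ε ⊤ τ) {X : V}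
    (hdec : ∃ᶠ i in atTop, Q.directTranslation.Decrements π (τ i).qual X) :
    ∃ᶠ i in atTop, Q.directTranslation.Increments π (τ i).qual X := by
  by_contra hinc
  rw [not_frequently, eventually_atTop] at hinc
  obtain ⟨b, hb⟩ := hinc
  have hanti : ∀ i j, b ≤ i → i ≤ j → (τ j).val X ≤ (τ i).val X := by
    intro i j hbi hij
    induction j, hij using Nat.le_induction with
    | base => exact le_rfl
    | succ j hj ih =>
      refine le_trans ?_ ih
      obtain ⟨a, ha, ⟨-, -, -, hd, hr⟩, -⟩ := h.2 j (ENat.natCast_lt_top _)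
      have hi : X ∉ (Q.action a).inc := fun h' =>
        hb j (hbi.trans hj) (increments_iff.2 ⟨a, ha, h'⟩)
      by_cases hX : X ∈ (Q.action a).dec
      · exact (hd X hX).le
      · exact (hr X hi hX).le
  -- Decrements to zero cannot occur, since another decrement would have to follow.
  have hdrop : ∀ i, b ≤ i → ∃ j, b ≤ j ∧ (τ j).val X + ε ≤ (τ i).val X := by
    intro i hi
    obtain ⟨j, hij, hj⟩ := frequently_atTop.1 hdec i
    obtain ⟨k, hjk, hk⟩ := frequently_atTop.1 hdec (j + 1)
    have hkpos : (τ k).val X ≠ 0 := not_inr_mem_of_decrements (h.edge (ENat.natCast_lt_top k)) hk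
    obtain ⟨a, ha, hX⟩ := decrements_iff.1 hj
    obtain ⟨a', ha', -, -, heps⟩ := h.2 j (ENat.natCast_lt_top _)
    obtain rfl : a = a' := Option.some_injective _ (ha.symm.trans ha')
    refine ⟨j + 1, by omega, ?_⟩
    rcases heps X hX with h' | h'
    · exact h'.trans (hanti i j hi hij)
    · exact absurd (le_antisymm (h' ▸ hanti (j + 1) k (by omega) hjk) zero_le) hkpos
  have hmany : ∀ n : ℕ, ∃ j, b ≤ j ∧ (τ j).val X + n • ε ≤ (τ b).val X := by
    intro n
    induction n with
    | zero => exact ⟨b, le_rfl, by simp⟩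
    | succ n ih =>
      obtain ⟨i, hi, hle⟩ := ih
      obtain ⟨j, hj, hle'⟩ := hdrop i hi
      refine ⟨j, hj, le_trans ?_ hle⟩
      rw [succ_nsmul', ← add_assoc]
      gcongr
  obtain ⟨n, hn⟩ := exists_lt_nsmul hε ((τ b).val X)
  obtain ⟨j, -, hj⟩ := hmany n
  exact absurd (lt_of_lt_of_le hn (le_trans le_add_self hj)) (lt_irrefl _)

/-- A state that occurs infinitely often on an `ε`-bounded trajectory does not terminate. -/
theorem IsTrajectory.not_stateTerminates_of_frequently [Finite At] [Finite V] {ε : NNReal}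
    (hε : 0 < ε) {τ : ℕ → NumState At V} (h : Q.IsTrajectory π ε ⊤ τ) {s : Set (At ⊕ V)}
    (hs : ∃ᶠ i in atTop, (τ i).qual = s) : ¬ Q.directTranslation.StateTerminates π s := by
  intro hT
  refine hT {t | ¬ ∃ᶠ i in atTop, (τ i).qual = t} (fun t hclause ht => ?_) hs
  have hev : ∀ᶠ i in atTop, ∃ᶠ j in atTop, (τ j).qual = (τ i).qual := by
    have : ∀ᶠ i in atTop, ∀ t : Set (At ⊕ V), ¬ (∃ᶠ j in atTop, (τ j).qual = t) →
        (τ i).qual ≠ t := by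
      rw [eventually_all]
      intro t
      by_cases ht : ∃ᶠ j in atTop, (τ j).qual = t
      · exact Eventually.of_forall fun _ h => absurd ht h
      · exact (not_frequently.1 ht).mono fun _ h _ => h
    exact this.mono fun i hi => by
      by_contra h'
      exact hi _ h' rfl
  obtain ⟨b, hb⟩ := eventually_atTop.1 hev
  -- The part of the trajectory between two late occurrences of `t` is a cycle of recurring states.
  have hcycle : ∀ m k, b ≤ m → m < k → (τ m).qual = t → (τ k).qual = t →
      Q.directTranslation.IsCycle π t (k - m) (fun i => (τ (m + i)).qual) ∧
        ∀ i, ∃ᶠ j in atTop, (τ j).qual = (τ (m + i)).qual := by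
    intro m k hm hmk h1 h2
    refine ⟨⟨by omega, h1, ?_, fun i _ => h.edge (ENat.natCast_lt_top _)⟩, fun i => hb _ (by omega)⟩
    have : m + (k - m) = k := by omega
    simpa only [this] using h2
  obtain ⟨m, hm, hmt⟩ := frequently_atTop.1 ht b
  obtain ⟨k, hk, hkt⟩ := frequently_atTop.1 ht (m + 1)
  rcases hclause with h1 | h2 | ⟨X, hX, h3⟩
  · exact h1 ⟨_, _, (hcycle m k hm hk hmt hkt).1⟩
  · obtain ⟨hc, hrec⟩ := hcycle m k hm hk hmt hkt
    obtain ⟨i, -, hi⟩ := h2 _ _ hc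
    exact hi (hrec i)
  · have hinc := h.frequently_increments hε (X := X) (ht.mono fun i hi => hi ▸ hX)
    obtain ⟨l, hl, hli⟩ := frequently_atTop.1 hinc m
    obtain ⟨k, hk, hkt⟩ := frequently_atTop.1 ht (l + 1)
    obtain ⟨hc, hrec⟩ := hcycle m k hm (by omega) hmt hkt
    obtain ⟨i, -, hi⟩ := h3 _ _ hc ⟨l - m, by omega, by
      have : m + (l - m) = l := by omega
      simpa only [this] using hli⟩
    exact hi (hrec i)

end QNP

theorem mainTheorem11 {At V Act : Type*} [Finite At] [Finite V] (Q : QNP At V Act)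
    (π : Set (At ⊕ V) → Option Act) (hπ : Q.directTranslation.IsPolicy π) :
    Q.Solves π ↔
      (Q.directTranslation.IsStrongCyclic π ∧ Q.directTranslation.Terminates π) := by
  refine ⟨fun h => ⟨h.isStrongCyclic hπ, h.terminates hπ⟩, ?_⟩
  rintro ⟨hsc, hterm⟩ ε hε N τ hτ hmax
  rcases hmax with rfl | ⟨n, rfl, ⟨hg, -⟩ | hdead⟩
  · -- Some qualitative state recurs, by the pigeonhole principle.
    obtain ⟨s, hs⟩ : ∃ s, ∃ᶠ i in atTop, (τ i).qual = s := by
      by_contra hno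
      simp only [not_exists, not_frequently] at hno
      obtain ⟨i, hi⟩ := (eventually_all.2 hno).exists
      exact hi _ rfl
    obtain ⟨i, rfl⟩ := hs.exists
    exact absurd (hterm _ (hτ.reaches le_top)) (hτ.not_stateTerminates_of_frequently hε hs)
  · exact ⟨n, le_rfl, hg⟩
  · refine ⟨n, le_rfl, ?_⟩
    by_contra hg
    obtain ⟨s', a, ha, hs'⟩ := hsc.exists_edge (hτ.reaches le_rfl)
      (fun h => hg (QNP.isGoal_qual.1 h))
    rcases hdead with h | ⟨b, hb, h⟩
    · simp [h] at ha
    · obtain rfl : a = b := Option.some_injective _ (ha.symm.trans hb)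
      exact h fun l hl => NumState.holds_translate_qual.1 ((QNP.mem_succ_iff.1 hs').1 l hl)
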